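/- Let $A,B\in\mathbb{R}^{2\times 2}$ and consider the bilinear control system $$\Sigma:\quad \dot x(t)=(A+u(t)B)\,x(t),\qquad x(t)\in\mathbb{R}^2\setminus\{0\},$$ whose admissible controls are all piecewise constant functions $u:\mathbb{R}\to\mathbb{R}$ (with finitely many switching times in each bounded interval, and unrestricted values). Let $\mathcal{L}_\Sigma\subset gl(2,\mathbb{R})$ be the Lie algebra generated by $\{A+uB: u\in\mathbb{R}\}$ under the commutator bracket. Suppose that 1. there are $\tilde A,\tilde B\in\mathcal{L}_\Sigma$ with $\operatorname{tr}^2\bigl(\operatorname{adj}(\tilde A)\tilde B\bigr)-4\det\bigl(\operatorname{adj}(\tilde A)\tilde B\bigr)<0$, where $\operatorname{adj}$ denotes the classical adjoint (adjugate) matrix; 2. there is $u\in\mathbb{R}$ such that $A+uB$ has a non-real complex eigenvalue, i.e. $\operatorname{tr}^2(A+uB)-4\det(A+uB)<0$; 3. $\operatorname{tr}(B)\neq 0$. Then $\Sigma$ is controllable on $\mathbb{R}^2\setminus\{0\}$: for all $p,q\in\mathbb{R}^2\setminus\{0\}$ there are an admissible control $u$, a time $T\ge 0$ and a trajectory $x$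 of $\Sigma$ for the control $u$ with $x(0)=p$ and $x(T)=q$. (A trajectory is a continuous curve in $\mathbb{R}^2\setminus\{0\}$ that satisfies the differential equation at all times other than the switching times of $u$.) -/

import Mathlib

open Filter Topology

attribute [local instance 100] LieRing.ofAssociativeRing

namespace BilinearControl

/-- Admissible controls: piecewise constant functions `u : ℝ → ℝ`, i.e. functions that are constant
near every point outside a set having only finitely many points in each bounded interval. -/
def IsAdmissible (u : ℝ → ℝ) : Prop :=
  ∃ D : Set ℝ, (∀ a b : ℝ, (D ∩ Set.Icc a b).Finite) ∧
    ∀ t : ℝ, t ∉ D → ∀ᶠ s in 𝓝 t, u s = u t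

/-- `x : ℝ → ℝ²` is a trajectory in `ℝ² ∖ {0}` of `ẋ = (A + u B) x` for the piecewise constant
control `u`: it is continuous, does not meet the origin, and satisfies the differential equation
at every time that is not a switching time of `u`. -/
def IsTrajectory (A B : Matrix (Fin 2) (Fin 2) ℝ) (u : ℝ → ℝ) (x : ℝ → Fin 2 → ℝ) : Prop :=
  Continuous x ∧ (∀ t, x t ≠ 0) ∧
    ∀ t : ℝ, (∀ᶠ s in 𝓝 t, u s = u t) → HasDerivAt x ((A + u t • B).mulVec (x t)) t

/-- Controllability of `ẋ = (A + u B) x` on `ℝ² ∖ {0}`: any nonzero point can be steered to any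
nonzero point in some finite nonnegative time by an admissible control. -/
def IsControllable (A B : Matrix (Fin 2) (Fin 2) ℝ) : Prop :=
  ∀ p q : Fin 2 → ℝ, p ≠ 0 → q ≠ 0 →
    ∃ u : ℝ → ℝ, IsAdmissible u ∧
      ∃ x : ℝ → Fin 2 → ℝ, IsTrajectory A B u x ∧ x 0 = p ∧ ∃ T : ℝ, 0 ≤ T ∧ x T = q

/-- The Lie algebra generated by the matrices `A + u B`, `u ∈ ℝ`, inside `gl(2, ℝ)` with the
commutator bracket. -/
def systemLieAlgebra (A B : Matrix (Fin 2) (Fin 2) ℝ) :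
    LieSubalgebra ℝ (Matrix (Fin 2) (Fin 2) ℝ) :=
  LieSubalgebra.lieSpan ℝ (Matrix (Fin 2) (Fin 2) ℝ) (Set.range fun u : ℝ => A + u • B)

/-- The real matrix `M` has a non-real complex eigenvalue. -/
def HasNonrealEigenvalue (M : Matrix (Fin 2) (Fin 2) ℝ) : Prop :=
  ∃ μ : ℂ, μ.im ≠ 0 ∧
    Module.End.HasEigenvalue (Matrix.toLin' (M.map ((↑) : ℝ → ℂ))) μ

/-- A real `2 × 2` matrix has a non-real eigenvalue iff its discriminant is negative. -/
theorem hasNonrealEigenvalue_iff (M : Matrix (Fin 2) (Fin 2) ℝ) :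
    HasNonrealEigenvalue M ↔ M.trace ^ 2 - 4 * M.det < 0 := by
  have key : ∀ μ : ℂ, Module.End.HasEigenvalue (Matrix.toLin' (M.map ((↑) : ℝ → ℂ))) μ ↔
      μ ^ 2 - M.trace * μ + M.det = 0 := by
    intro μ
    rw [Module.End.hasEigenvalue_iff_isRoot_charpoly, Matrix.charpoly_toLin',
      Matrix.charpoly_fin_two]
    simp [Polynomial.IsRoot, Matrix.trace_fin_two, Matrix.det_fin_two]
  simp only [HasNonrealEigenvalue, key]
  constructor
  · rintro ⟨μ, h, h2⟩
    have h3 := congrArg Complex.re h2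
    have h4 := congrArg Complex.im h2
    simp [pow_two] at h3 h4
    have h5 : M.trace = 2 * μ.re := by
      apply mul_right_cancel₀ h
      linarith
    have h6 : 0 < μ.im ^ 2 := by positivity
    rw [h5] at h3 ⊢
    nlinarith
  · intro h
    have h0 : 0 < 4 * M.det - M.trace ^ 2 := by linarith
    obtain ⟨r, hr, hr2⟩ : ∃ r : ℝ, 0 < r ∧ r * r = 4 * M.det - M.trace ^ 2 :=
      ⟨_, Real.sqrt_pos.2 h0, Real.mul_self_sqrt h0.le⟩
    refine ⟨⟨M.trace / 2, r / 2⟩, (half_pos hr).ne', ?_⟩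
    apply Complex.ext <;> simp [pow_two] <;> nlinarith

end BilinearControl

/-! A control value with nonreal eigenvalues makes every solution spiral, so every ray is reached
(`Reach.exists_smul`); only the radius remains to be corrected. Since `tr B ≠ 0`, some `N = A + u B`
has trace zero. If `det N < 0`, eigenvectors with eigenvalues of both signs allow growth and decay
(`isControllable_of_det_neg`). If `det N > 0`, control values near `u` give spirals with small
growth rates of either sign, and full turns realise any factor (`isControllable_of_det_pos`). If
`det N = 0`, then `N` is nilpotent, and nonzero by the Lie algebra condition; the determinant then
has nonzero derivative along the line at `u`, so it is negative nearby, which is the first case. -/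

namespace BilinearControl

open Matrix

/-! ### Reachability: scaling and concatenation -/

/-- `q` can be reached from `p` in finite nonnegative time. -/
def Reach (A B : Matrix (Fin 2) (Fin 2) ℝ) (p q : Fin 2 → ℝ) : Prop :=
  ∃ u : ℝ → ℝ, IsAdmissible u ∧
    ∃ x : ℝ → Fin 2 → ℝ, IsTrajectory A B u x ∧ x 0 = p ∧ ∃ T : ℝ, 0 ≤ T ∧ x T = q

variable {A B : Matrix (Fin 2) (Fin 2) ℝ}

/-- A global solution for a constant control connects its value at `0` to its later values. -/
theorem Reach.of_solution (u : ℝ) (x : ℝ → Fin 2 → ℝ) (hx0 : ∀ t, x t ≠ 0)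
    (hx : ∀ t, HasDerivAt x ((A + u • B) *ᵥ x t) t) {T : ℝ} (hT : 0 ≤ T) :
    Reach A B (x 0) (x T) :=
  ⟨fun _ => u, ⟨∅, by simp, by simp⟩, x,
    ⟨continuous_iff_continuousAt.2 fun t => (hx t).continuousAt, hx0, fun t _ => hx t⟩,
    rfl, T, hT, rfl⟩

theorem Reach.smul {p q : Fin 2 → ℝ} (h : Reach A B p q) {c : ℝ} (hc : c ≠ 0) :
    Reach A B (c • p) (c • q) := by
  obtain ⟨u, hu, x, ⟨hxc, hx0, hx⟩, rfl, T, hT, rfl⟩ := h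
  refine ⟨u, hu, fun t => c • x t, ⟨hxc.const_smul c, fun t => smul_ne_zero hc (hx0 t), ?_⟩,
    rfl, T, hT, rfl⟩
  intro t ht
  rw [mulVec_smul]
  exact (hx t ht).const_smul c

/-- Gluing of two functions at time `T`, with prescribed value `v` at `T`. -/
noncomputable def glue {X : Type*} (T : ℝ) (f g : ℝ → X) (v : X) (t : ℝ) : X :=
  if t < T then f t else if t = T then v else g (t - T)

theorem glue_eventuallyEq_left {X : Type*} {T t : ℝ} (f g : ℝ → X) (v : X) (h : t < T) :
    glue T f g v =ᶠ[𝓝 t] f := by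
  filter_upwards [gt_mem_nhds h] with s hs
  simp [glue, hs]

theorem glue_eventuallyEq_right {X : Type*} {T t : ℝ} (f g : ℝ → X) (v : X) (h : T < t) :
    glue T f g v =ᶠ[𝓝 t] fun s => g (s - T) := by
  filter_upwards [lt_mem_nhds h] with s hs
  simp [glue, hs.not_gt, hs.ne']

theorem tendsto_sub_nhds (t T : ℝ) : Tendsto (fun s : ℝ => s - T) (𝓝 t) (𝓝 (t - T)) :=
  (continuous_sub_right T).tendsto t

theorem tendsto_add_nhds (t T : ℝ) : Tendsto (fun s : ℝ => s + T) (𝓝 (t - T)) (𝓝 t) := by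
  simpa using (continuous_add_const T).tendsto (t - T)

/-- The value at a single point can be chosen so that the function is not locally constant there. -/
theorem exists_not_eventually_eq (w : ℝ → ℝ) (T : ℝ) : ∃ v : ℝ, ¬ ∀ᶠ s in 𝓝[≠] T, w s = v := by
  by_contra! h
  obtain ⟨s, h0, h1⟩ := ((h 0).and (h 1)).exists
  exact zero_ne_one (h0.symm.trans h1)

theorem isAdmissible_glue {u₁ u₂ : ℝ → ℝ} (h₁ : IsAdmissible u₁) (h₂ : IsAdmissible u₂)
    (T v : ℝ) : IsAdmissible (glue T u₁ u₂ v) := by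
  obtain ⟨D₁, hD₁, h₁⟩ := h₁
  obtain ⟨D₂, hD₂, h₂⟩ := h₂
  refine ⟨D₁ ∪ {T} ∪ (fun s => s - T) ⁻¹' D₂, fun a b => ?_, fun t ht => ?_⟩
  · rw [Set.union_inter_distrib_right, Set.union_inter_distrib_right]
    refine ((hD₁ a b).union ((Set.finite_singleton T).inter_of_left _)).union ?_
    refine ((hD₂ (a - T) (b - T)).preimage
      (f := fun s : ℝ => s - T) (sub_left_injective.injOn)).subset ?_
    rintro s ⟨hs, hs1, hs2⟩
    exact ⟨hs, sub_le_sub_right hs1 T, sub_le_sub_right hs2 T⟩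
  · simp only [Set.mem_union, Set.mem_singleton_iff, Set.mem_preimage, not_or] at ht
    obtain ⟨⟨ht1, htT⟩, ht2⟩ := ht
    rcases lt_or_gt_of_ne htT with hlt | hlt
    · have e := glue_eventuallyEq_left u₁ u₂ v hlt
      filter_upwards [e, h₁ t ht1] with s hs hs'
      rw [hs, hs', e.eq_of_nhds]
    · have e := glue_eventuallyEq_right u₁ u₂ v hlt
      filter_upwards [e, (tendsto_sub_nhds t T).eventually (h₂ _ ht2)] with s hs hs'
      rw [hs, hs', e.eq_of_nhds]

theorem Reach.trans {p q r : Fin 2 → ℝ} (h₁ : Reach A B p q) (h₂ : Reach A B q r) :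
    Reach A B p r := by
  obtain ⟨u₁, hu₁, x₁, ⟨hc₁, hn₁, hx₁⟩, rfl, T₁, hT₁, rfl⟩ := h₁
  obtain ⟨u₂, hu₂, x₂, ⟨hc₂, hn₂, hx₂⟩, h0, T₂, hT₂, rfl⟩ := h₂
  -- The value `v` makes `T₁` a genuine switching time, so the differential equation need not be
  -- checked at the junction.
  obtain ⟨v, hv⟩ := exists_not_eventually_eq (glue T₁ u₁ u₂ 0) T₁
  have hx : glue T₁ x₁ x₂ (x₁ T₁) = fun t => if t ≤ T₁ then x₁ t else x₂ (t - T₁) := by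
    funext t
    rcases lt_trichotomy t T₁ with h | h | h
    · simp [glue, h, h.le]
    · simp [glue, h]
    · simp [glue, h.not_gt, h.ne', h.not_ge]
  refine ⟨glue T₁ u₁ u₂ v, isAdmissible_glue hu₁ hu₂ T₁ v, glue T₁ x₁ x₂ (x₁ T₁),
    ⟨?_, fun t => ?_, fun t ht => ?_⟩, ?_, T₁ + T₂, add_nonneg hT₁ hT₂, ?_⟩
  · rw [hx]
    refine Continuous.if_le hc₁ (hc₂.comp (continuous_sub_right T₁)) continuous_id
      continuous_const ?_
    rintro t rfl
    simp [h0]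
  · rw [hx]
    dsimp only
    split_ifs
    · exact hn₁ t
    · exact hn₂ _
  · rcases lt_trichotomy t T₁ with h | h | h
    · have eu := glue_eventuallyEq_left u₁ u₂ v h
      have ex := glue_eventuallyEq_left x₁ x₂ (x₁ T₁) h
      rw [ex.eq_of_nhds, eu.eq_of_nhds]
      refine (hx₁ t ?_).congr_of_eventuallyEq ex
      filter_upwards [ht, eu] with s hs hs'
      rw [← hs', hs, eu.eq_of_nhds]
    · subst h
      refine absurd ?_ hv
      filter_upwards [ht.filter_mono nhdsWithin_le_nhds, self_mem_nhdsWithin] with s hs hs'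
      have hs' : s ≠ t := hs'
      simpa [glue, hs'] using hs
    · have eu := glue_eventuallyEq_right u₁ u₂ v h
      have ex := glue_eventuallyEq_right x₁ x₂ (x₁ T₁) h
      rw [ex.eq_of_nhds, eu.eq_of_nhds]
      refine HasDerivAt.congr_of_eventuallyEq ?_ ex
      refine (hx₂ (t - T₁) ?_).comp_sub_const t T₁
      filter_upwards [(tendsto_add_nhds t T₁).eventually ht,
        (tendsto_add_nhds t T₁).eventually eu] with s hs hs'
      rw [hs, eu.eq_of_nhds] at hs'
      simpa using hs'.symm
  · rw [hx]
    simp [hT₁]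
  · rw [hx]
    rcases hT₂.eq_or_lt with h | h
    · simp [← h, h0]
    · simp [h.not_ge]

/-- Scaling along an eigenvector. -/
theorem Reach.of_eigenvector {u l : ℝ} {v : Fin 2 → ℝ} (hv : v ≠ 0)
    (h : (A + u • B) *ᵥ v = l • v) {T : ℝ} (hT : 0 ≤ T) :
    Reach A B v (Real.exp (l * T) • v) := by
  have key := Reach.of_solution (A := A) (B := B) u (fun t => Real.exp (l * t) • v)
    (fun t => smul_ne_zero (Real.exp_pos _).ne' hv) (fun t => ?_) hT
  · simpa using key
  · rw [mulVec_smul, h, smul_smul]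
    have := ((hasDerivAt_id t).const_mul l).exp.smul_const v
    simpa using this

/-! ### Spirals -/

/-- The solution of `ẋ = M x`, `x 0 = p`, for `M` with trace `2 τ` and determinant `τ² + w²`. -/
noncomputable def spiral (M : Matrix (Fin 2) (Fin 2) ℝ) (τ w : ℝ) (p : Fin 2 → ℝ) (t : ℝ) :
    Fin 2 → ℝ :=
  Real.exp (τ * t) • (Real.cos (w * t) • p + (Real.sin (w * t) / w) • (M *ᵥ p - τ • p))

section Spiral

variable {M : Matrix (Fin 2) (Fin 2) ℝ} {τ w : ℝ}

/-- The Cayley–Hamilton theorem for `M`, with trace and determinant in terms of `τ` and `w`. -/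
theorem mulVec_mulVec_of_trace_det (htr : M.trace = 2 * τ) (hdet : M.det = τ ^ 2 + w ^ 2)
    (p : Fin 2 → ℝ) : M *ᵥ (M *ᵥ p) = (2 * τ) • (M *ᵥ p) - (τ ^ 2 + w ^ 2) • p := by
  rw [← htr, ← hdet, trace_fin_two, det_fin_two]
  ext i
  fin_cases i <;> simp [mulVec, dotProduct, Fin.sum_univ_two] <;> ring

/-- By Cayley–Hamilton `(M - τ)² = -w²`, so `spiral` is `exp (t M) p`. -/
theorem hasDerivAt_spiral (htr : M.trace = 2 * τ) (hdet : M.det = τ ^ 2 + w ^ 2) (hw : w ≠ 0)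
    (p : Fin 2 → ℝ) (t : ℝ) :
    HasDerivAt (spiral M τ w p) (M *ᵥ spiral M τ w p t) t := by
  have hl (c : ℝ) : HasDerivAt (fun t : ℝ => c * t) c t := by
    simpa using (hasDerivAt_id t).const_mul c
  have h := (hl τ).exp.smul (((hl w).cos.smul_const p).add
    (((hl w).sin.div_const w).smul_const (M *ᵥ p - τ • p)))
  refine h.congr_deriv ?_
  simp only [spiral, mulVec_smul, mulVec_add, mulVec_sub, mulVec_mulVec_of_trace_det htr hdet]
  ext i
  simp only [Pi.add_apply, Pi.smul_apply, Pi.sub_apply, smul_eq_mul]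
  field_simp
  ring

/-- For `p ≠ 0` the vectors `p` and `M p` are linearly independent. -/
theorem cross_ne_zero (htr : M.trace = 2 * τ) (hdet : M.det = τ ^ 2 + w ^ 2) (hw : w ≠ 0)
    {p : Fin 2 → ℝ} (hp : p ≠ 0) : p 0 * (M *ᵥ p) 1 - p 1 * (M *ᵥ p) 0 ≠ 0 := by
  intro h
  apply hp
  rw [trace_fin_two] at htr
  rw [det_fin_two] at hdet
  simp only [mulVec, dotProduct, Fin.sum_univ_two] at h
  have hw2 : 0 < w ^ 2 := by positivity
  obtain rfl : τ = (M 0 0 + M 1 1) / 2 := by linarith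
  -- The cross product is a quadratic form in `p` of discriminant `-4w²`; completing the square in
  -- either variable shows that it is definite.
  have h1 : (M 1 0 * p 0 - (M 0 0 - M 1 1) / 2 * p 1) ^ 2 + w ^ 2 * p 1 ^ 2 = 0 := by
    linear_combination M 1 0 * h - p 1 ^ 2 * hdet
  have h2 : (M 0 1 * p 1 + (M 0 0 - M 1 1) / 2 * p 0) ^ 2 + w ^ 2 * p 0 ^ 2 = 0 := by
    linear_combination -M 0 1 * h - p 0 ^ 2 * hdet
  have e1 : p 1 = 0 := by
    have : w ^ 2 * p 1 ^ 2 = 0 := by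
      nlinarith [sq_nonneg (M 1 0 * p 0 - (M 0 0 - M 1 1) / 2 * p 1),
        mul_nonneg hw2.le (sq_nonneg (p 1))]
    simpa [hw] using this
  have e0 : p 0 = 0 := by
    have : w ^ 2 * p 0 ^ 2 = 0 := by
      nlinarith [sq_nonneg (M 0 1 * p 1 + (M 0 0 - M 1 1) / 2 * p 0),
        mul_nonneg hw2.le (sq_nonneg (p 0))]
    simpa [hw] using this
  ext i
  fin_cases i <;> simp [e0, e1]

theorem spiral_ne_zero (htr : M.trace = 2 * τ) (hdet : M.det = τ ^ 2 + w ^ 2) (hw : w ≠ 0)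
    {p : Fin 2 → ℝ} (hp : p ≠ 0) (t : ℝ) : spiral M τ w p t ≠ 0 := by
  intro h
  have h := (smul_eq_zero.1 h).resolve_left (Real.exp_pos _).ne'
  have h0 := congrFun h 0
  have h1 := congrFun h 1
  have hD := cross_ne_zero htr hdet hw hp
  simp only [Pi.add_apply, Pi.smul_apply, Pi.sub_apply, smul_eq_mul, Pi.zero_apply] at h0 h1
  have hs : Real.sin (w * t) / w = 0 := by
    refine (mul_eq_zero.1 (?_ : Real.sin (w * t) / w * _ = 0)).resolve_right hD
    linear_combination p 0 * h1 - p 1 * h0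
  have hs' : Real.sin (w * t) = 0 := by simpa [hw] using hs
  have hc : Real.cos (w * t) ≠ 0 := by
    intro hc
    have := Real.sin_sq_add_cos_sq (w * t)
    simp [hs', hc] at this
  apply hp
  simp only [hs, zero_mul, add_zero, mul_eq_zero, hc, false_or] at h0 h1
  ext i
  fin_cases i <;> simp [h0, h1]

/-- A spiral meets every ray at some nonnegative time. -/
theorem exists_spiral_eq_smul (htr : M.trace = 2 * τ) (hdet : M.det = τ ^ 2 + w ^ 2) (hw : 0 < w)
    {p q : Fin 2 → ℝ} (hp : p ≠ 0) (hq : q ≠ 0) :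
    ∃ T : ℝ, 0 ≤ T ∧ ∃ c : ℝ, 0 < c ∧ spiral M τ w p T = c • q := by
  have hD := cross_ne_zero htr hdet hw.ne' hp
  obtain ⟨a, b, hab⟩ : ∃ a b : ℝ, q = a • p + (b / w) • (M *ᵥ p - τ • p) := by
    set D := p 0 * (M *ᵥ p) 1 - p 1 * (M *ᵥ p) 0 with hDdef
    set b := (p 0 * q 1 - p 1 * q 0) / D
    set a := (q 0 * (M *ᵥ p) 1 - q 1 * (M *ᵥ p) 0) / D
    have hb : b * D = p 0 * q 1 - p 1 * q 0 := div_mul_cancel₀ _ hD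
    have ha : a * D = q 0 * (M *ᵥ p) 1 - q 1 * (M *ᵥ p) 0 := div_mul_cancel₀ _ hD
    -- Cramer's rule gives `q = a p + b M p`, regrouped here in terms of `M p - τ p`.
    refine ⟨a + b * τ, b * w, ?_⟩
    rw [mul_div_cancel_right₀ _ hw.ne']
    ext i
    apply mul_right_cancel₀ hD
    simp only [Pi.add_apply, Pi.smul_apply, Pi.sub_apply, smul_eq_mul]
    fin_cases i
    · simp only [Fin.zero_eta]
      linear_combination -p 0 * ha - (M *ᵥ p) 0 * hb + q 0 * hDdef
    · simp only [Fin.mk_one]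
      linear_combination -p 1 * ha - (M *ᵥ p) 1 * hb + q 1 * hDdef
  -- The angle `w T` is the argument of `z`, increased by `2π` to make `T` nonnegative.
  set z : ℂ := ⟨a, b⟩ with hz
  have hz0 : z ≠ 0 := by
    intro h0
    have h1 : a = 0 := congrArg Complex.re h0
    have h2 : b = 0 := congrArg Complex.im h0
    exact hq (by simp [hab, h1, h2])
  have hr : 0 < ‖z‖ := norm_pos_iff.2 hz0
  have hca : Real.cos (z.arg + 2 * Real.pi) = a / ‖z‖ := by
    rw [Real.cos_add_two_pi, Complex.cos_arg hz0]
  have hsb : Real.sin (z.arg + 2 * Real.pi) = b / ‖z‖ := by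
    rw [Real.sin_add_two_pi, Complex.sin_arg]
  refine ⟨(z.arg + 2 * Real.pi) / w, ?_, Real.exp (τ * ((z.arg + 2 * Real.pi) / w)) / ‖z‖,
    div_pos (Real.exp_pos _) hr, ?_⟩
  · have := Complex.neg_pi_lt_arg z
    have := Real.pi_pos
    exact div_nonneg (by linarith) hw.le
  · rw [spiral, mul_div_cancel₀ _ hw.ne', hca, hsb, hab]
    ext i
    simp only [Pi.add_apply, Pi.smul_apply, Pi.sub_apply, smul_eq_mul]
    field_simp

theorem spiral_zero (p : Fin 2 → ℝ) : spiral M τ w p 0 = p := by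
  simp [spiral]

theorem spiral_full_turns (hw : w ≠ 0) (p : Fin 2 → ℝ) (n : ℕ) :
    spiral M τ w p (n * (2 * Real.pi) / w) =
      Real.exp (τ * (n * (2 * Real.pi) / w)) • p := by
  have hs : Real.sin (n * (2 * Real.pi)) = 0 := by
    simpa using Real.sin_add_nat_mul_two_pi 0 n
  rw [spiral, mul_div_cancel₀ _ hw, Real.cos_nat_mul_two_pi, hs]
  simp

end Spiral

theorem Reach.spiral {u τ w : ℝ} (htr : (A + u • B).trace = 2 * τ)
    (hdet : (A + u • B).det = τ ^ 2 + w ^ 2) (hw : w ≠ 0) {p : Fin 2 → ℝ} (hp : p ≠ 0)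
    {T : ℝ} (hT : 0 ≤ T) : Reach A B p (spiral (A + u • B) τ w p T) := by
  have := Reach.of_solution u _ (spiral_ne_zero htr hdet hw hp)
    (hasDerivAt_spiral htr hdet hw p) hT
  rwa [spiral_zero] at this

/-- Under a control value with nonreal eigenvalues every ray is reached. -/
theorem Reach.exists_smul {u : ℝ} (h : (A + u • B).trace ^ 2 - 4 * (A + u • B).det < 0)
    {p q : Fin 2 → ℝ} (hp : p ≠ 0) (hq : q ≠ 0) : ∃ c : ℝ, 0 < c ∧ Reach A B p (c • q) := by
  have hD : 0 < (A + u • B).det - ((A + u • B).trace / 2) ^ 2 := by linarith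
  have htr : (A + u • B).trace = 2 * ((A + u • B).trace / 2) := by ring
  have hdet : (A + u • B).det = ((A + u • B).trace / 2) ^ 2 +
      √((A + u • B).det - ((A + u • B).trace / 2) ^ 2) ^ 2 := by
    rw [Real.sq_sqrt hD.le]
    ring
  obtain ⟨T, hT, c, hc, e⟩ := exists_spiral_eq_smul htr hdet (Real.sqrt_pos.2 hD) hp hq
  exact ⟨c, hc, e ▸ Reach.spiral htr hdet (Real.sqrt_pos.2 hD).ne' hp hT⟩

/-! ### Radial correction along eigenvectors -/

theorem exists_eigenvector {M : Matrix (Fin 2) (Fin 2) ℝ} {l : ℝ}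
    (h : l ^ 2 - M.trace * l + M.det = 0) : ∃ v : Fin 2 → ℝ, v ≠ 0 ∧ M *ᵥ v = l • v := by
  have hd : (M - l • (1 : Matrix (Fin 2) (Fin 2) ℝ)).det = 0 := by
    rw [det_fin_two] at h ⊢
    rw [trace_fin_two] at h
    simp
    linarith
  obtain ⟨v, hv, e⟩ := exists_mulVec_eq_zero_iff.2 hd
  refine ⟨v, hv, ?_⟩
  rw [sub_mulVec, smul_mulVec, one_mulVec] at e
  exact sub_eq_zero.1 e

/-- A matrix with negative determinant has a positive and a negative eigenvalue. -/
theorem exists_eigenvectors_of_det_neg {M : Matrix (Fin 2) (Fin 2) ℝ} (h : M.det < 0) :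
    (∃ l : ℝ, 0 < l ∧ ∃ v : Fin 2 → ℝ, v ≠ 0 ∧ M *ᵥ v = l • v) ∧
      ∃ l : ℝ, l < 0 ∧ ∃ v : Fin 2 → ℝ, v ≠ 0 ∧ M *ᵥ v = l • v := by
  have h0 : 0 ≤ M.trace ^ 2 - 4 * M.det := by nlinarith [sq_nonneg M.trace]
  have hs := Real.sq_sqrt h0
  have habs : |M.trace| < √(M.trace ^ 2 - 4 * M.det) := by
    apply Real.lt_sqrt_of_sq_lt
    rw [sq_abs]
    linarith
  obtain ⟨h1, h2⟩ := abs_lt.1 habs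
  refine ⟨⟨(M.trace + √(M.trace ^ 2 - 4 * M.det)) / 2, by linarith, exists_eigenvector ?_⟩,
    ⟨(M.trace - √(M.trace ^ 2 - 4 * M.det)) / 2, by linarith, exists_eigenvector ?_⟩⟩
  · linear_combination hs / 4
  · linear_combination hs / 4

/-- A control value with nonreal eigenvalues and one with negative determinant give
controllability. -/
theorem isControllable_of_det_neg {u₀ u₁ : ℝ}
    (h₀ : (A + u₀ • B).trace ^ 2 - 4 * (A + u₀ • B).det < 0) (h₁ : (A + u₁ • B).det < 0) :
    IsControllable A B := by
  intro p q hp hq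
  obtain ⟨⟨l₁, hl₁, v₁, hv₁, e₁⟩, l₂, hl₂, v₂, hv₂, e₂⟩ := exists_eigenvectors_of_det_neg h₁
  obtain ⟨a, ha, r₁⟩ := Reach.exists_smul h₀ hp hv₁
  obtain ⟨b, hb, r₂⟩ := Reach.exists_smul h₀ (smul_ne_zero ha.ne' hv₁) hv₂
  obtain ⟨c, hc, r₃⟩ := Reach.exists_smul h₀ (smul_ne_zero hb.ne' hv₂) hq
  have hc' : c⁻¹ • c • q = q := inv_smul_smul₀ hc.ne' q
  have he : Real.exp (-Real.log c) = c⁻¹ := by rw [Real.exp_neg, Real.exp_log hc]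
  -- The route through both eigenvectors ends at `c q`. The missing factor `c⁻¹` is gained by growth
  -- along `v₁` if `c ≤ 1`, by decay along `v₂` otherwise; the rest of the route is rescaled.
  rcases le_total c 1 with h | h
  · have hT : 0 ≤ -Real.log c / l₁ :=
      div_nonneg (neg_nonneg.2 (Real.log_nonpos hc.le h)) hl₁.le
    have s := (Reach.of_eigenvector hv₁ e₁ hT).smul ha.ne'
    rw [mul_div_cancel₀ _ hl₁.ne', he, smul_comm] at s
    have := (r₂.trans r₃).smul (inv_ne_zero hc.ne')
    rw [hc'] at this
    exact r₁.trans (s.trans this)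
  · have hT : 0 ≤ -Real.log c / l₂ :=
      div_nonneg_of_nonpos (neg_nonpos.2 (Real.log_nonneg h)) hl₂.le
    have s := (Reach.of_eigenvector hv₂ e₂ hT).smul hb.ne'
    rw [mul_div_cancel₀ _ hl₂.ne, he, smul_comm] at s
    have := r₃.smul (inv_ne_zero hc.ne')
    rw [hc'] at this
    exact r₁.trans (r₂.trans (s.trans this))

/-! ### Radial correction by full turns -/

/-- Full turns with small rate of growth `k h / √(D h)` per turn produce every rate of growth. -/
theorem exists_nat_mul_eq {D : ℝ → ℝ} (hD : Continuous D) (hD0 : 0 < D 0) {k : ℝ} (hk : k ≠ 0)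
    (s : ℝ) : ∃ h : ℝ, 0 < D h ∧ ∃ n : ℕ, k * h * n = s * √(D h) := by
  obtain ⟨δ, hδ, hball⟩ :=
    Metric.eventually_nhds_iff.1 (hD.continuousAt.eventually (lt_mem_nhds hD0))
  obtain ⟨e, he, hed⟩ : ∃ e, 0 < e ∧ e < δ := exists_between hδ
  have hpos {h : ℝ} (hh : |h| ≤ e) : 0 < D h := hball (by
    rw [Real.dist_eq, sub_zero]
    linarith)
  -- For such `n` the term `k h n` dominates at `h = ±e`, so the difference of the two sides changes
  -- sign on `[-e, e]`.
  obtain ⟨n, hn⟩ := exists_nat_ge ((|s * √(D e)| + |s * √(D (-e))|) / (|k| * e))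
  have hke : 0 < |k| * e := by positivity
  rw [div_le_iff₀ hke] at hn
  have hke' : |k * e * n| = n * (|k| * e) := by
    rw [abs_mul, abs_mul, abs_of_pos he, Nat.abs_cast]
    ring
  have hcont : ContinuousOn (fun h => k * h * n - s * √(D h)) (Set.uIcc (-e) e) := by
    fun_prop
  have hmem : (0 : ℝ) ∈ Set.uIcc (k * -e * n - s * √(D (-e))) (k * e * n - s * √(D e)) := by
    have h1 := le_abs_self (s * √(D e))
    have h2 := le_abs_self (s * √(D (-e)))
    have h3 := neg_abs_le (s * √(D e))
    have h4 := neg_abs_le (s * √(D (-e)))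
    rw [Set.mem_uIcc]
    rcases le_total 0 (k * e * n) with h | h
    · rw [abs_of_nonneg h] at hke'
      left
      constructor <;> nlinarith [abs_nonneg (s * √(D e)), abs_nonneg (s * √(D (-e)))]
    · rw [abs_of_nonpos h] at hke'
      right
      constructor <;> nlinarith [abs_nonneg (s * √(D e)), abs_nonneg (s * √(D (-e)))]
  obtain ⟨h, hh, h0⟩ := intermediate_value_uIcc hcont hmem
  rw [Set.uIcc_of_le (by linarith)] at hh
  exact ⟨h, hpos (abs_le.2 hh), n, sub_eq_zero.1 h0⟩

/-- A control value with trace zero and positive determinant gives controllability if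
`B.trace ≠ 0`. -/
theorem isControllable_of_det_pos {u : ℝ} (htr : (A + u • B).trace = 0)
    (hdet : 0 < (A + u • B).det) (hB : B.trace ≠ 0) : IsControllable A B := by
  intro p q hp hq
  obtain ⟨c, hc, r⟩ := Reach.exists_smul (A := A) (B := B) (u := u)
    (by rw [htr]; linarith) hp hq
  have htr' (h : ℝ) : (A + (u + h) • B).trace = 2 * (h * B.trace / 2) := by
    rw [add_smul, ← add_assoc, trace_add, htr, trace_smul, smul_eq_mul]
    ring
  -- With `τ = h tr B / 2` and `T = 2πn / w`, the equation `τ T = -log c` reads `(tr B · π) h n =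
  -- -log c · w`.
  obtain ⟨h, hD, n, hn⟩ := exists_nat_mul_eq
    (D := fun h => (A + (u + h) • B).det - (h * B.trace / 2) ^ 2) (by
      simp only [det_fin_two, Matrix.add_apply, Matrix.smul_apply, smul_eq_mul]
      fun_prop) (by simpa using hdet)
    (mul_ne_zero hB Real.pi_ne_zero) (-Real.log c)
  have hw := Real.sqrt_pos.2 hD
  have hsq := Real.sq_sqrt hD.le
  set w := √((A + (u + h) • B).det - (h * B.trace / 2) ^ 2)
  have s := Reach.spiral (htr' h) (by rw [hsq]; ring) hw.ne' (smul_ne_zero hc.ne' hq)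
    (T := n * (2 * Real.pi) / w) (by positivity)
  have hexp : h * B.trace / 2 * (n * (2 * Real.pi) / w) = -Real.log c := by
    field_simp
    linear_combination hn
  rw [spiral_full_turns hw.ne', hexp, Real.exp_neg, Real.exp_log hc, inv_smul_smul₀ hc.ne'] at s
  exact r.trans s

/-! ### The nilpotent case -/

/-- A nilpotent matrix orthogonal (for the trace form) to a matrix with nonreal eigenvalues is
zero. -/
theorem eq_zero_of_trace_mul_eq_zero {N M : Matrix (Fin 2) (Fin 2) ℝ} (htr : N.trace = 0)
    (hdet : N.det = 0) (hM : M.trace ^ 2 - 4 * M.det < 0) (h : (N * M).trace = 0) : N = 0 := by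
  rw [trace_fin_two] at htr hM h
  rw [det_fin_two] at hdet hM
  simp only [mul_apply, Fin.sum_univ_two] at h
  have e : N 1 1 = -N 0 0 := by linarith
  rw [e] at h hdet
  have hM' : (M 0 0 - M 1 1) ^ 2 + 4 * (M 0 1 * M 1 0) < 0 := by linarith
  -- The negative discriminant of `M` times `N 0 1 ^ 2` is a square, which forces `N 0 1 = 0`;
  -- likewise for `N 1 0`.
  have k1 : (N 0 1 * (M 0 0 - M 1 1) - 2 * N 0 0 * M 0 1) ^ 2 =
      N 0 1 ^ 2 * ((M 0 0 - M 1 1) ^ 2 + 4 * (M 0 1 * M 1 0)) := by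
    linear_combination (-4 * N 0 1 * M 0 1) * h - 4 * M 0 1 ^ 2 * hdet
  have k2 : (N 1 0 * (M 0 0 - M 1 1) - 2 * N 0 0 * M 1 0) ^ 2 =
      N 1 0 ^ 2 * ((M 0 0 - M 1 1) ^ 2 + 4 * (M 0 1 * M 1 0)) := by
    linear_combination (-4 * N 1 0 * M 1 0) * h - 4 * M 1 0 ^ 2 * hdet
  have n1 : N 0 1 = 0 := by
    by_contra hne
    have := mul_neg_of_pos_of_neg (pow_pos (abs_pos.2 hne) 2) hM'
    rw [sq_abs, ← k1] at this
    exact absurd this (sq_nonneg _).not_gt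
  have n2 : N 1 0 = 0 := by
    by_contra hne
    have := mul_neg_of_pos_of_neg (pow_pos (abs_pos.2 hne) 2) hM'
    rw [sq_abs, ← k2] at this
    exact absurd this (sq_nonneg _).not_gt
  have n0 : N 0 0 = 0 := by
    rw [n1] at hdet
    have : N 0 0 ^ 2 = 0 := by linear_combination -hdet
    simpa using this
  ext i j
  fin_cases i <;> fin_cases j <;> simp [n0, n1, n2, e]

theorem exists_quadratic_neg {a b : ℝ} (ha : a ≠ 0) : ∃ h : ℝ, h * a + h ^ 2 * b < 0 := by
  have hpos : 0 < 1 + |b| := by positivity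
  -- The denominator exceeds `b`, so the linear term outweighs the quadratic one.
  refine ⟨-a / (1 + |b|), ?_⟩
  have : -a / (1 + |b|) * a + (-a / (1 + |b|)) ^ 2 * b =
      a ^ 2 * (b - (1 + |b|)) / (1 + |b|) ^ 2 := by
    field_simp
    ring
  rw [this]
  refine div_neg_of_neg_of_pos (mul_neg_of_pos_of_neg (by positivity) ?_) (by positivity)
  linarith [le_abs_self b]

/-- If some `A + u B` is nonzero, nilpotent, and some `A + u₀ B` has nonreal eigenvalues, then
the determinant is negative somewhere on the line. -/
theorem exists_det_neg_of_nilpotent {u u₀ : ℝ} (htr : (A + u • B).trace = 0)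
    (hdet : (A + u • B).det = 0) (hne : A + u • B ≠ 0)
    (h₀ : (A + u₀ • B).trace ^ 2 - 4 * (A + u₀ • B).det < 0) : ∃ v : ℝ, (A + v • B).det < 0 := by
  -- This is the derivative of the determinant at `N = A + u B`. If it vanished, `N` would be
  -- trace-orthogonal to `B` and to itself, hence to `A + u₀ B`.
  have hNB : -((A + u • B) * B).trace ≠ 0 := by
    intro hz
    refine hne (eq_zero_of_trace_mul_eq_zero htr hdet h₀ ?_)
    have hNN : ((A + u • B) * (A + u • B)).trace = 0 := by
      have : ((A + u • B) * (A + u • B)).trace =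
          (A + u • B).trace ^ 2 - 2 * (A + u • B).det := by
        generalize A + u • B = N
        rw [trace_fin_two, trace_fin_two, det_fin_two]
        simp only [mul_apply, Fin.sum_univ_two]
        ring
      rw [this, htr, hdet]
      norm_num
    have : A + u₀ • B = (A + u • B) + (u₀ - u) • B := by
      rw [sub_smul]
      abel
    rw [this, mul_add, trace_add, hNN, mul_smul_comm, trace_smul, neg_eq_zero.1 hz]
    simp
  obtain ⟨h, hh⟩ := exists_quadratic_neg (b := B.det) hNB
  refine ⟨u + h, ?_⟩
  have : (A + (u + h) • B).det = (A + u • B).det +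
      h * ((A + u • B).trace * B.trace - ((A + u • B) * B).trace) + h ^ 2 * B.det := by
    simp only [trace_fin_two, det_fin_two, mul_apply, Fin.sum_univ_two, Matrix.add_apply,
      Matrix.smul_apply, smul_eq_mul]
    ring
  rw [this, hdet, htr]
  linarith

/-! ### The Lie algebra condition -/

/-- If the line `A + u B` passes through zero, the system Lie algebra consists of multiples
of `B`. -/
theorem exists_smul_of_mem_systemLieAlgebra {u : ℝ} (h : A + u • B = 0)
    {M : Matrix (Fin 2) (Fin 2) ℝ} (hM : M ∈ systemLieAlgebra A B) : ∃ c : ℝ, c • B = M := by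
  let L : LieSubalgebra ℝ (Matrix (Fin 2) (Fin 2) ℝ) :=
    { Submodule.span ℝ {B} with
      lie_mem' := by
        intro X Y hX hY
        obtain ⟨a, rfl⟩ := Submodule.mem_span_singleton.1 hX
        obtain ⟨b, rfl⟩ := Submodule.mem_span_singleton.1 hY
        simp }
  have hle : systemLieAlgebra A B ≤ L := by
    refine LieSubalgebra.lieSpan_le.2 ?_
    rintro _ ⟨v, rfl⟩
    refine Submodule.mem_span_singleton.2 ⟨v - u, ?_⟩
    simp only [eq_neg_of_add_eq_zero_left h, sub_eq_neg_add, add_smul, neg_smul]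
  exact Submodule.mem_span_singleton.1 (hle hM)

/-- Otherwise `A'` and `B'` are multiples of `B`, and `adj(A') B'` is a scalar matrix, whose
discriminant is zero. -/
theorem add_smul_ne_zero_of_rank
    (h_rank : ∃ A' ∈ systemLieAlgebra A B, ∃ B' ∈ systemLieAlgebra A B,
      (A'.adjugate * B').trace ^ 2 - 4 * (A'.adjugate * B').det < 0) (u : ℝ) :
    A + u • B ≠ 0 := by
  intro h
  obtain ⟨A', hA, B', hB, hlt⟩ := h_rank
  obtain ⟨a, rfl⟩ := exists_smul_of_mem_systemLieAlgebra h hA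
  obtain ⟨b, rfl⟩ := exists_smul_of_mem_systemLieAlgebra h hB
  refine hlt.ne ?_
  simp only [trace_fin_two, det_fin_two, adjugate_fin_two, mul_apply, Fin.sum_univ_two,
    Matrix.smul_apply, smul_eq_mul, of_apply, cons_val', cons_val_zero, cons_val_one,
    cons_val_fin_one]
  ring

end BilinearControl

theorem mainTheorem5 (A B : Matrix (Fin 2) (Fin 2) ℝ)
    (h_rank : ∃ A' ∈ BilinearControl.systemLieAlgebra A B,
      ∃ B' ∈ BilinearControl.systemLieAlgebra A B,
        (A'.adjugate * B').trace ^ 2 - 4 * (A'.adjugate * B').det < 0)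
    (h_eig : ∃ u : ℝ, BilinearControl.HasNonrealEigenvalue (A + u • B))
    (h_tr : B.trace ≠ 0) :
    BilinearControl.IsControllable A B := by
  obtain ⟨u₀, h₀⟩ := h_eig
  rw [BilinearControl.hasNonrealEigenvalue_iff] at h₀
  obtain ⟨u, hu⟩ : ∃ u : ℝ, (A + u • B).trace = 0 := by
    refine ⟨-A.trace / B.trace, ?_⟩
    rw [Matrix.trace_add, Matrix.trace_smul, smul_eq_mul, div_mul_cancel₀ _ h_tr]
    ring
  rcases lt_trichotomy (A + u • B).det 0 with h | h | h
  · exact BilinearControl.isControllable_of_det_neg h₀ h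
  · obtain ⟨v, hv⟩ := BilinearControl.exists_det_neg_of_nilpotent hu h
      (BilinearControl.add_smul_ne_zero_of_rank h_rank u) h₀
    exact BilinearControl.isControllable_of_det_neg h₀ hv
  · exact BilinearControl.isControllable_of_det_pos hu h h_tr
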